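/- \textbf{Types and functionals.} The finite types are $0$, of rank $\mathbf r(0)=0$, and $\sigma=(\sigma_1,\dots,\sigma_n\to 0)$, of rank $\mathbf r(\sigma)=\max_i(\mathbf r(\sigma_i)+1)$, where $(\sigma_1,\dots,\sigma_n\to0)$ is identified with $\sigma_1\to(\sigma_2,\dots,\sigma_n\to 0)$; write $1=(0\to0)$ and $2=(1\to 0)$. Let $\mathbf F(0)=\mathbb N$ and $\mathbf P(0)=\mathbb N_\bot=\mathbb N\cup\{\bot\}$; for $\sigma=(\sigma_1,\dots,\sigma_n\to0)$, let $\mathbf F(\sigma)$ (total functionals) and $\mathbf P(\sigma)$ (partial functionals) be the sets of all maps from $\mathbf F(\sigma_1)\times\dots\times\mathbf F(\sigma_n)$ to $\mathbb N$ and to $\mathbb N_\bot$, respectively. Thus $\mathbf F(\sigma)\subseteq\mathbf P(\sigma)$, and $\mathbf P(\sigma)$ is ordered by extension $\preceq$. \textbf{Computability.} Terms are built from typed variables of types of rank $\le 3$ and the constants $0$, $\mathsf{suc}$, $\mathsf{pred}$ (with $\mathsf{pred}(0)=0$) and $\mathsf{case}$ of type $0,0,0\to0$, by application, by abstraction $\lambda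 x^\sigma t$ with $t$ of type $\tau$ and $\mathbf r(\sigma\to\tau)\le 3$, and by $\mu x^\sigma t$ with $t$ of type $\sigma$ and $\mathbf r(\sigma)\le 3$. Relative to an assignment of partial functionals to the free variables, a term $t$ of type $\sigma$ has an interpretation $[[t]]\in\mathbf P(\sigma)$, monotone in the assignment: $[[uv]]=[[u]]([[v]])$ if $[[v]]$ is total, and $[[uv]]$ is everywhere undefined otherwise; $[[\lambda x t]]$ maps each total $\phi$ to the value of $t$ at $x=\phi$; $[[\mu xt]]$ is the least fixed point of the operator $x\mapsto[[t]]$; $\mathsf{case}(z,x,y)$ is undefined if $z=\bot$, is $x$ if $z=0$, and is $y$ if $z>0$, where the argument that is not selected may be undefined. A partial functional $\psi$ is \emph{computable in} $\Phi$ if there is a term $s$ with at most one free variable $x$, of the type of $\Phi$, such that $\psi\preceq[[s]]$ when $x$ is assigned $\Phi$. \textbf{Countably based functionals.} Let $\sigma=(\tau_1,\dots,\tau_n\to0)$ have rank $\le3$, where $\tau_i=(\delta_{i,1},\dots,\delta_{i,m_i}\to0)$. A total $\Phi\in\mathbf F(\sigma)$ is \emph{countably based} if for all $(F_1,\dots,F_n)\in\mathbf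 F(\tau_1)\times\dots\times\mathbf F(\tau_n)$ there are countable sets $X_i\subseteq\mathbf F(\delta_{i,1})\times\dots\times\mathbf F(\delta_{i,m_i})$ such that $\Phi(F_1,\dots,F_n)=\Phi(G_1,\dots,G_n)$ whenever $F_i$ and $G_i$ are equal on $X_i$ for each $i=1,\dots,n$. \textbf{The functional $\Omega_1$.} Let $\Omega_1\in\mathbf P(2\to1)$ be the partial functional that is defined exactly at the characteristic functions $F\in\mathbf F(2)$ of the singletons $\{x\}\subseteq\mathbb N^{\mathbb N}$, where $\Omega_1(F)=x$. \textbf{Theorem.} Let $\Phi$ be a total countably based functional of a type of rank $3$. Then $\Omega_1$ is not computable in $\Phi$. -/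

import Mathlib

namespace HigherComp

/-- Types of finite rank, in curried form: every type is `0` or of the form
`σ₁ → (σ₂ → ⋯ → (σₙ → 0))`, the latter being the type written `(σ₁, …, σₙ → 0)`. -/
inductive Ty : Type
  | nat : Ty
  | arr : Ty → Ty → Ty

namespace Ty

/-- The rank: `r(0) = 0` and `r(σ₁, …, σₙ → 0) = max (r(σᵢ) + 1)`. -/
def rank : Ty → ℕ
  | nat => 0
  | arr σ τ => max (rank σ + 1) (rank τ)

/-- The pure types of rank `1` and `2`. -/
abbrev one : Ty := arr nat nat
abbrev two : Ty := arr one nat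

end Ty

/-- The total functionals of a type. -/
def Tot : Ty → Type
  | .nat => ℕ
  | .arr σ τ => Tot σ → Tot τ

/-- The partial functionals of a type: they take total arguments only, and their values lie
in `ℕ ∪ {⊥}`, which is `Part ℕ`. -/
def Par : Ty → Type
  | .nat => Part ℕ
  | .arr σ τ => Tot σ → Par τ

/-- The extension order `⪯`: pointwise, from the flat order on `Part ℕ`. -/
instance Par.instPartialOrder : (σ : Ty) → PartialOrder (Par σ)
  | .nat => inferInstanceAs (PartialOrder (Part ℕ))
  | .arr σ τ =>
    letI := Par.instPartialOrder τ
    inferInstanceAs (PartialOrder (Tot σ → Par τ))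

/-- The everywhere undefined functional. -/
def Par.undef : (σ : Ty) → Par σ
  | .nat => (Part.none : Part ℕ)
  | .arr _ τ => fun _ => Par.undef τ

/-- A total functional seen as a partial one. -/
def Tot.toPar : (σ : Ty) → Tot σ → Par σ
  | .nat, n => Part.some (n : ℕ)
  | .arr _ τ, f => fun x => Tot.toPar τ (f x)

open Classical in
/-- Application of a partial functional to a partial object: everywhere undefined unless the
argument is total. -/
noncomputable def Par.app {σ τ : Ty} (u : Par (.arr σ τ)) (v : Par σ) : Par τ :=
  if h : ∃ x : Tot σ, Tot.toPar σ x = v then u h.choose else Par.undef τ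

open Classical in
/-- The least fixed point of an operator (which exists for the monotone ones, see
`Par.isLeast_lfp`). -/
noncomputable def Par.lfp {σ : Ty} (f : Par σ → Par σ) : Par σ :=
  if h : ∃ ψ, IsLeast {ψ | f ψ = ψ} ψ then h.choose else Par.undef σ

theorem Par.undef_le : ∀ {σ : Ty} (φ : Par σ), Par.undef σ ≤ φ
  | .nat, φ => (bot_le : (⊥ : Part ℕ) ≤ φ)
  | .arr _ _, φ => fun x => Par.undef_le (φ x)

theorem Par.exists_isLUB : ∀ {σ : Ty} (c : Set (Par σ)), IsChain (· ≤ ·) c →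
    ∃ φ, IsLUB c φ
  | .nat, c, hc => by
    change Set (Part ℕ) at c
    by_cases h : ∃ n : ℕ, Part.some n ∈ c
    · obtain ⟨n, hn⟩ := h
      refine ⟨(Part.some n : Part ℕ), fun p hp => ?_, fun q hq => hq hn⟩
      rcases hc.total hp hn with h | h
      · exact h
      · intro m hm
        have h1 := h n (Part.mem_some n)
        have h2 : m = n := Part.mem_unique hm h1
        subst h2
        exact Part.mem_some m
    · refine ⟨(Part.none : Part ℕ), fun p hp m hm => ?_, fun q _ => (bot_le : (⊥ : Part ℕ) ≤ q)⟩
      exact absurd ⟨m, (Part.eq_some_iff.2 hm : p = Part.some m) ▸ hp⟩ h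
  | .arr σ τ, c, hc => by
    have key : ∀ x : Tot σ, ∃ φ : Par τ, IsLUB ((fun f : Par (.arr σ τ) => f x) '' c) φ := by
      intro x
      refine Par.exists_isLUB _ ?_
      rintro _ ⟨f, hf, rfl⟩ _ ⟨g, hg, rfl⟩ _
      exact (hc.total hf hg).imp (fun h => h x) (fun h => h x)
    choose φ hφ using key
    refine ⟨φ, fun f hf x => (hφ x).1 ⟨f, hf, rfl⟩, fun g hg x => (hφ x).2 ?_⟩
    rintro _ ⟨f, hf, rfl⟩
    exact hg hf x

/-- A monotone operator has a least fixed point, which also is its least pre-fixed point. -/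
theorem Par.exists_lfp {σ : Ty} (f : Par σ → Par σ) (hf : Monotone f) :
    ∃ ψ, f ψ = ψ ∧ ∀ χ, f χ ≤ χ → ψ ≤ χ := by
  let A : Set (Par σ) := {ψ | ψ ≤ f ψ ∧ ∀ χ, f χ ≤ χ → ψ ≤ χ}
  obtain ⟨m, hm⟩ := zorn_le₀ A (by
    intro c hcA hc
    obtain ⟨u, hu⟩ := Par.exists_isLUB c hc
    refine ⟨u, ⟨hu.2 fun ψ hψ => ?_, fun χ hχ => hu.2 fun ψ hψ => (hcA hψ).2 χ hχ⟩, hu.1⟩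
    exact (hcA hψ).1.trans (hf (hu.1 hψ)))
  have hfm : f m ∈ A := ⟨hf hm.1.1, fun χ hχ => (hf (hm.1.2 χ hχ)).trans hχ⟩
  exact ⟨m, le_antisymm (hm.2 hfm hm.1.1) hm.1.1, hm.1.2⟩

theorem Par.isLeast_lfp {σ : Ty} (f : Par σ → Par σ) (hf : Monotone f) :
    IsLeast {ψ | f ψ = ψ} (Par.lfp f) := by
  have h : ∃ ψ, IsLeast {ψ | f ψ = ψ} ψ := by
    obtain ⟨ψ, h1, h2⟩ := Par.exists_lfp f hf
    exact ⟨ψ, h1, fun χ hχ => h2 χ (le_of_eq hχ)⟩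
  unfold Par.lfp
  rw [dif_pos h]
  exact h.choose_spec

theorem Par.lfp_le {σ : Ty} (f : Par σ → Par σ) (hf : Monotone f) {χ : Par σ} (h : f χ ≤ χ) :
    Par.lfp f ≤ χ := by
  obtain ⟨ψ, h1, h2⟩ := Par.exists_lfp f hf
  exact ((Par.isLeast_lfp f hf).2 h1).trans (h2 χ h)

/-- Typed variables of a context (de Bruijn indices). -/
inductive Var : List Ty → Ty → Type
  | here {Γ : List Ty} {σ : Ty} : Var (σ :: Γ) σ
  | there {Γ : List Ty} {σ τ : Ty} : Var Γ σ → Var (τ :: Γ) σ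

/-- Terms without secondary constants, with free variables among those of the context `Γ`.

The constant `case` of type `0, 0, 0 → 0` comes as a term former with three arguments, since it
is strict only in its first argument; the constant itself is its `λ`-abstraction. -/
inductive Term : List Ty → Ty → Type
  | var {Γ : List Ty} {σ : Ty} : σ.rank ≤ 3 → Var Γ σ → Term Γ σ
  | zero {Γ : List Ty} : Term Γ .nat
  | suc {Γ : List Ty} : Term Γ .one
  | pred {Γ : List Ty} : Term Γ .one
  | case {Γ : List Ty} : Term Γ .nat → Term Γ .nat → Term Γ .nat → Term Γ .nat
  | app {Γ : List Ty} {σ τ : Ty} : Term Γ (.arr σ τ) → Term Γ σ → Term Γ τ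
  | lam {Γ : List Ty} {σ τ : Ty} : (Ty.arr σ τ).rank ≤ 3 → Term (σ :: Γ) τ → Term Γ (.arr σ τ)
  | mu {Γ : List Ty} {σ : Ty} : σ.rank ≤ 3 → Term (σ :: Γ) σ → Term Γ σ

/-- Assignments of partial objects to the variables of a context. -/
def Env : List Ty → Type
  | [] => Unit
  | σ :: Γ => Par σ × Env Γ

/-- The object assigned to a variable. -/
def Env.get : {Γ : List Ty} → {σ : Ty} → Env Γ → Var Γ σ → Par σ
  | _, _, ρ, .here => ρ.1
  | _, _, ρ, .there x => Env.get ρ.2 x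

/-- The value of `case` on `z`, `x`, `y`: it is `x` if `z = 0`, it is `y` if `z` is a positive
integer, and it is undefined if `z` is. -/
def caseVal (z x y : Part ℕ) : Part ℕ :=
  z.bind fun n => if n = 0 then x else y

/-- The interpretation of terms. -/
noncomputable def Term.interp : {Γ : List Ty} → {σ : Ty} → Term Γ σ → Env Γ → Par σ
  | _, _, .var _ x, ρ => ρ.get x
  | _, _, .zero, _ => Part.some 0
  | _, _, .suc, _ => fun n : ℕ => Part.some (n + 1)
  | _, _, .pred, _ => fun n : ℕ => Part.some (n - 1)
  | _, _, .case z x y, ρ => caseVal (z.interp ρ) (x.interp ρ) (y.interp ρ)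
  | _, _, .app u v, ρ => Par.app (u.interp ρ) (v.interp ρ)
  | _, _, .lam (σ := σ) _ t, ρ => fun x => t.interp (Tot.toPar σ x, ρ)
  | _, _, .mu _ t, ρ => Par.lfp fun ψ => t.interp (ψ, ρ)

theorem Tot.toPar_injective : ∀ σ : Ty, Function.Injective (Tot.toPar σ)
  | .nat => fun _ _ h => Part.some_injective (α := ℕ) h
  | .arr _ τ => fun _ _ h => funext fun x => Tot.toPar_injective τ (congrFun h x)

theorem Par.app_toPar {σ τ : Ty} (u : Par (.arr σ τ)) (x : Tot σ) :
    Par.app u (Tot.toPar σ x) = u x := by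
  have h : ∃ y : Tot σ, Tot.toPar σ y = Tot.toPar σ x := ⟨x, rfl⟩
  unfold Par.app
  rw [dif_pos h, Tot.toPar_injective σ h.choose_spec]

/-- Total functionals are maximal. -/
theorem Tot.eq_of_toPar_le : ∀ {σ : Ty} {x : Tot σ} {φ : Par σ}, Tot.toPar σ x ≤ φ →
    φ = Tot.toPar σ x
  | .nat, x, _, h => Part.eq_some_iff.2 (h (x : ℕ) (Part.mem_some (x : ℕ)))
  | .arr _ _, _, _, h => funext fun y => Tot.eq_of_toPar_le (h y)

theorem Par.app_mono {σ τ : Ty} {u u' : Par (.arr σ τ)} {v v' : Par σ} (hu : u ≤ u')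
    (hv : v ≤ v') : Par.app u v ≤ Par.app u' v' := by
  by_cases h : ∃ x : Tot σ, Tot.toPar σ x = v
  · obtain ⟨x, rfl⟩ := h
    rw [Tot.eq_of_toPar_le hv, Par.app_toPar, Par.app_toPar]
    exact hu x
  · have : Par.app u v = Par.undef τ := dif_neg h
    rw [this]
    exact Par.undef_le _

/-- The pointwise extension order on assignments. -/
def Env.Le : {Γ : List Ty} → Env Γ → Env Γ → Prop
  | [], _, _ => True
  | _ :: _, ρ, ρ' => ρ.1 ≤ ρ'.1 ∧ Env.Le ρ.2 ρ'.2

theorem Env.Le.refl : ∀ {Γ : List Ty} (ρ : Env Γ), Env.Le ρ ρ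
  | [], _ => trivial
  | _ :: _, ρ => ⟨le_refl ρ.1, Env.Le.refl ρ.2⟩

theorem Env.Le.get : ∀ {Γ : List Ty} {σ : Ty} {ρ ρ' : Env Γ} (x : Var Γ σ), Env.Le ρ ρ' →
    ρ.get x ≤ ρ'.get x
  | _, _, _, _, .here, h => h.1
  | _, _, _, _, .there x, h => Env.Le.get x h.2

theorem caseVal_mono {z z' x x' y y' : Part ℕ} (hz : z ≤ z') (hx : x ≤ x') (hy : y ≤ y') :
    caseVal z x y ≤ caseVal z' x' y' := by
  intro m hm
  simp only [caseVal, Part.mem_bind_iff] at hm ⊢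
  obtain ⟨n, hn, h⟩ := hm
  refine ⟨n, hz n hn, ?_⟩
  split_ifs at h ⊢
  · exact hx m h
  · exact hy m h

/-- The interpretation of a term is monotone. In particular, every `μ`-term is interpreted by an
actual least fixed point. -/
theorem Term.interp_mono {Γ : List Ty} {σ : Ty} (t : Term Γ σ) :
    ∀ {ρ ρ' : Env Γ}, Env.Le ρ ρ' → t.interp ρ ≤ t.interp ρ' := by
  induction t with
  | var _ x => exact fun h => h.get x
  | zero => exact fun _ => le_refl _
  | suc => exact fun _ => le_refl _
  | pred => exact fun _ => le_refl _
  | case z x y hz hx hy => exact fun h => caseVal_mono (hz h) (hx h) (hy h)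
  | app u v hu hv => exact fun h => Par.app_mono (hu h) (hv h)
  | lam _ t ht => exact fun h x => ht ⟨le_refl _, h⟩
  | mu _ t ht =>
    intro ρ ρ' h
    have hm : ∀ ρ, Monotone fun ψ => t.interp (ψ, ρ) :=
      fun ρ ψ χ hψ => ht ⟨hψ, Env.Le.refl ρ⟩
    change Par.lfp (fun ψ => t.interp (ψ, ρ)) ≤ Par.lfp (fun ψ => t.interp (ψ, ρ'))
    refine Par.lfp_le _ (hm ρ) ?_
    refine le_trans (ht (ρ' := (Par.lfp (fun ψ => t.interp (ψ, ρ')), ρ')) ⟨le_refl _, h⟩) ?_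
    exact le_of_eq (Par.isLeast_lfp _ (hm ρ')).1

/-- `ψ` is computable in `φ₁, …, φₙ` (the components of `φ`): some term with free variables
`x₁, …, xₙ` and without secondary constants has, at `φ₁, …, φₙ`, an interpretation that
extends `ψ`. -/
def ComputableIn {τ : Ty} (ψ : Par τ) {Γ : List Ty} (φ : Env Γ) : Prop :=
  ∃ s : Term Γ τ, ψ ≤ s.interp φ

/-- Argument tuples of the functionals of a type: `F(σ₁) × ⋯ × F(σₙ)` for `σ₁, …, σₙ → 0`. -/
def Args : Ty → Type
  | .nat => Unit
  | .arr σ τ => Tot σ × Args τ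

/-- The value of a total functional at an argument tuple. -/
def Tot.eval : {σ : Ty} → Tot σ → Args σ → ℕ
  | .nat, n, _ => n
  | .arr _ _, f, a => Tot.eval (f a.1) a.2

/-- Families `(X₁, …, Xₙ)`, for the type `τ₁, …, τₙ → 0`, of sets `Xᵢ` of argument tuples of the
functionals of type `τᵢ`. -/
def Support : Ty → Type
  | .nat => Unit
  | .arr σ τ => Set (Args σ) × Support τ

/-- All members of the family are countable. -/
def Support.Countable : {σ : Ty} → Support σ → Prop
  | .nat, _ => True
  | .arr _ _, X => X.1.Countable ∧ Support.Countable X.2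

/-- The argument tuples `(F₁, …, Fₙ)` and `(G₁, …, Gₙ)` are such that `Fᵢ` and `Gᵢ` are equal
on `Xᵢ` for each `i`. -/
def Support.Agree : {σ : Ty} → Support σ → Args σ → Args σ → Prop
  | .nat, _, _, _ => True
  | .arr _ _, X, a, b =>
    (∀ x ∈ X.1, Tot.eval a.1 x = Tot.eval b.1 x) ∧ Support.Agree X.2 a.2 b.2

/-- A total functional is countably based if each of its values has a countable support.
(The notion is meant for types of rank at most `3`.) -/
def CountablyBased {σ : Ty} (Φ : Tot σ) : Prop :=
  ∀ a : Args σ, ∃ X : Support σ, X.Countable ∧ ∀ b : Args σ, X.Agree a b → Φ.eval a = Φ.eval b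

/-- `F` is the characteristic function of the set `X` of elements of Baire space. -/
def IsChar (F : (ℕ → ℕ) → ℕ) (X : Set (ℕ → ℕ)) : Prop :=
  ∀ y, (y ∈ X → F y = 1) ∧ (y ∉ X → F y = 0)

/-- The partial functional `Ω₁`, of type `2 → 1`: it is defined exactly at the characteristic
functions of the sets `{x}`, where its value is `x`. -/
noncomputable def Omega1 : Par (.arr .two .one) :=
  fun (F : (ℕ → ℕ) → ℕ) (k : ℕ) => (⟨∃ x, IsChar F {x}, fun h => h.choose k⟩ : Part ℕ)

end HigherComp

/-!
The members of a family `(φᵢ)` of functionals are compared along a countably complete filter. Call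
a family of natural numbers in `ℕ ∪ {⊥}` uniform if it is eventually constant as soon as it is
eventually defined, and extend this to all types as a logical relation. All terms preserve
uniformity. The critical case is `μ`: one approximates the least fixed points of the members by
transfinite stages, the stage depending on the member, and uses that eventual strict comparison of
families of ordinals is well-founded, because the filter is countably complete.

A uniform family of argument tuples of rank at most `2` agrees, eventually and on any given
countable support, with one fixed tuple, so the constant family of a countably based functional of
rank at most `3` is uniform. The constant family of `Ω₁` is not: along the cocountable filter on
Baire space the characteristic functions of the singletons `{x}` form a uniform family, but the
points `x`, which `Ω₁` recovers, do not.
-/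

namespace HigherComp

open Filter Set

section LfpApprox

universe u

variable {α : Type u} [PartialOrder α]

/-- The transfinite approximations from below to the least fixed point of a monotone operator on a
chain-complete partial order: at stage `a` the supremum of the `f (lfpApprox f b)` for `b < a`.
The supremum is picked by `Classical.epsilon`, and arbitrary if there is none. -/
noncomputable def lfpApprox [Nonempty α] (f : α → α) (a : Ordinal.{u}) : α :=
  Classical.epsilon (IsLUB (range fun b : Iio a => f (lfpApprox f b)))
termination_by a
decreasing_by exact b.2

variable [Nonempty α] {f : α → α}

theorem isLUB_lfpApprox (hα : ∀ c : Set α, IsChain (· ≤ ·) c → ∃ x, IsLUB c x)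
    (hf : Monotone f) (a : Ordinal.{u}) :
    IsLUB (range fun b : Iio a => f (lfpApprox f b)) (lfpApprox f a) := by
  induction a using WellFoundedLT.induction with
  | ind a ih =>
    have hmono : Monotone fun b : Iio a => f (lfpApprox f b) := fun b c hbc =>
      hf <| (ih b b.2).mono (ih c c.2) <| range_subset_iff.2 fun d =>
        ⟨⟨d, Iio_subset_Iio (Subtype.coe_le_coe.2 hbc) d.2⟩, rfl⟩
    rw [lfpApprox]
    exact Classical.epsilon_spec (hα _ hmono.isChain_range)

theorem lfpApprox_le (hα : ∀ c : Set α, IsChain (· ≤ ·) c → ∃ x, IsLUB c x)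
    (hf : Monotone f) {x : α} (hx : f x ≤ x) (a : Ordinal.{u}) : lfpApprox f a ≤ x := by
  induction a using WellFoundedLT.induction with
  | ind a ih =>
    exact (isLUB_lfpApprox hα hf a).2 (forall_mem_range.2 fun b => (hf (ih b b.2)).trans hx)

theorem exists_isLeast_lfpApprox (hα : ∀ c : Set α, IsChain (· ≤ ·) c → ∃ x, IsLUB c x)
    (hf : Monotone f) : ∃ a : Ordinal.{u}, IsLeast {x | f x = x} (lfpApprox f a) := by
  by_contra! h
  refine not_injective_of_ordinal (lfpApprox f) <|
    Function.Injective.of_lt_imp_ne fun a b hab e => h a ?_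
  have hle : f (lfpApprox f a) ≤ lfpApprox f a :=
    ((isLUB_lfpApprox hα hf b).1 ⟨⟨a, hab⟩, rfl⟩).trans e.ge
  exact ⟨hle.antisymm (lfpApprox_le hα hf (hf hle) a),
    fun x hx => lfpApprox_le hα hf (le_of_eq hx) a⟩

end LfpApprox

instance {σ : Ty} : Nonempty (Par σ) :=
  ⟨Par.undef σ⟩

theorem Par.exists_lfpApprox_eq_lfp {σ : Ty} {f : Par σ → Par σ} (hf : Monotone f) :
    ∃ a, lfpApprox f a = Par.lfp f := by
  obtain ⟨a, ha⟩ := exists_isLeast_lfpApprox Par.exists_isLUB hf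
  exact ⟨a, ha.unique (Par.isLeast_lfp f hf)⟩

theorem mem_of_isLUB_of_dom {α : Type*} {c : Set (Part α)} {p : Part α} (h : IsLUB c p)
    (hp : p.Dom) : p ∈ c := by
  by_contra hpc
  have hnone : p ≤ Part.none := h.2 fun q hq x hx => by
    have hpq : p = q :=
      (Part.eq_some_iff.2 (h.1 hq x hx)).trans (Part.eq_some_iff.2 hx).symm
    exact absurd (hpq ▸ hq) hpc
  exact Part.notMem_none _ (hnone _ (Part.get_mem hp))

theorem wellFounded_eventually_lt {ι α : Type*} [LT α] [WellFoundedLT α] (l : Filter ι)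
    [l.NeBot] [CountableInterFilter l] :
    WellFounded fun f g : ι → α => ∀ᶠ i in l, f i < g i := by
  rw [wellFounded_iff_isEmpty_descending_chain]
  refine ⟨fun ⟨u, hu⟩ => ?_⟩
  obtain ⟨i, hi⟩ := (eventually_countable_forall.2 hu).exists
  exact (wellFounded_iff_isEmpty_descending_chain.1 (wellFounded_lt (α := α))).false
    ⟨fun n => u n i, hi⟩

section Uniform

variable {ι : Type*} {l : Filter ι}

/-- Uniformity, along a filter, of a family of partial functionals: it maps uniform families of
total arguments to families of values that are eventually constant as soon as they are eventually
defined. -/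
def Uniform (l : Filter ι) : (σ : Ty) → (ι → Par σ) → Prop
  | .nat, p => (∀ᶠ i in l, (p i : Part ℕ).Dom) → ∃ n : ℕ, ∀ᶠ i in l, (p i : Part ℕ) = Part.some n
  | .arr σ τ, φ => ∀ a : ι → Tot σ, Uniform l σ (fun i => Tot.toPar σ (a i)) →
      Uniform l τ fun i => φ i (a i)

theorem Uniform.mono : ∀ {σ : Ty} {φ ψ : ι → Par σ}, Uniform l σ ψ → φ ≤ᶠ[l] ψ → Uniform l σ φ
  | .nat, φ, ψ, hψ, hle => fun hφ => by
    have heq : ∀ᶠ i in l, (ψ i : Part ℕ) = φ i := by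
      filter_upwards [hle, hφ] with i hi hdom
      exact (Part.eq_some_iff.2 (hi _ (Part.get_mem hdom))).trans (Part.some_get hdom)
    obtain ⟨n, hn⟩ := hψ <| by
      filter_upwards [hφ, heq] with i hdom hi using hi ▸ hdom
    exact ⟨n, by filter_upwards [hn, heq] with i hi hi' using hi'.symm.trans hi⟩
  | .arr _ _, _, _, hψ, hle => fun a ha => (hψ a ha).mono (hle.mono fun i hi => hi (a i))

theorem Uniform.congr {σ : Ty} {φ ψ : ι → Par σ} (hφ : Uniform l σ φ) (h : φ =ᶠ[l] ψ) :
    Uniform l σ ψ :=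
  hφ.mono h.symm.le

theorem uniform_of_frequently_undef : ∀ {σ : Ty} {φ : ι → Par σ},
    (∃ᶠ i in l, φ i = Par.undef σ) → Uniform l σ φ
  | .nat, _, h => fun hdom => by
    obtain ⟨i, hi, hi'⟩ := (h.and_eventually hdom).exists
    exact absurd (hi ▸ hi') Part.not_none_dom
  | .arr _ _, _, h => fun a _ => uniform_of_frequently_undef (h.mono fun i hi => congrFun hi (a i))

theorem uniform_of_isLUB [l.NeBot] : ∀ {σ : Ty} {c : ι → Set (Par σ)} {φ : ι → Par σ},
    (∀ i, IsLUB (c i) (φ i)) → (∀ ψ : ι → Par σ, (∀ᶠ i in l, ψ i ∈ c i) → Uniform l σ ψ) →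
    Uniform l σ φ
  | .nat, _, φ, hφ, hc => fun hdom =>
    hc φ (hdom.mono fun i hi => mem_of_isLUB_of_dom (hφ i) hi) hdom
  | .arr σ τ, c, φ, hφ, hc => fun a ha => by
    have hLUB (i : ι) : IsLUB (Function.eval (a i) '' c i) (φ i (a i)) :=
      (isLUB_pi (π := fun _ : Tot σ => Par τ)).1 (hφ i) (a i)
    refine uniform_of_isLUB hLUB fun ψ hψ => ?_
    obtain ⟨χ, hχ⟩ := Eventually.choice hψ
    exact (hc χ (hχ.mono fun _ hi => hi.1) a ha).congr (hχ.mono fun _ hi => hi.2)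

theorem uniform_nat_const [l.NeBot] (p : Part ℕ) : Uniform l .nat fun _ => p := fun hdom =>
  have ⟨_, hp⟩ := hdom.exists
  ⟨p.get hp, Eventually.of_forall fun _ => (Part.some_get hp).symm⟩

theorem Uniform.bind {p : ι → Part ℕ} {k : ℕ → ι → Part ℕ} (hp : Uniform l .nat p)
    (hk : ∀ n, Uniform l .nat (k n)) : Uniform l .nat fun i => (p i).bind fun n => k n i := by
  intro hdom
  obtain ⟨n, hn⟩ := hp (hdom.mono fun _ hi => hi.fst)
  have heq : k n =ᶠ[l] fun i => (p i).bind fun n => k n i :=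
    hn.mono fun i hi => by simp only [hi, Part.bind_some]
  exact (hk n).congr heq hdom

theorem Uniform.caseVal {z x y : ι → Part ℕ} (hz : Uniform l .nat z) (hx : Uniform l .nat x)
    (hy : Uniform l .nat y) : Uniform l .nat fun i => HigherComp.caseVal (z i) (x i) (y i) :=
  hz.bind fun n => by split_ifs <;> assumption

theorem Uniform.app [l.NeBot] {σ τ : Ty} {u : ι → Par (.arr σ τ)} {v : ι → Par σ}
    (hu : Uniform l (.arr σ τ) u) (hv : Uniform l σ v) :
    Uniform l τ fun i => Par.app (u i) (v i) := by
  by_cases h : ∀ᶠ i in l, ∃ x : Tot σ, Tot.toPar σ x = v i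
  · obtain ⟨a, ha⟩ := h.choice
    refine (hu a (hv.congr (ha.mono fun i hi => hi.symm))).congr (ha.mono fun i hi => ?_)
    simp only [← hi, Par.app_toPar]
  · exact uniform_of_frequently_undef ((not_eventually.1 h).mono fun i hi => dif_neg hi)

theorem Uniform.lfp [l.NeBot] [CountableInterFilter l] {σ : Ty} {f : ι → Par σ → Par σ}
    (hmono : ∀ i, Monotone (f i))
    (hf : ∀ φ : ι → Par σ, Uniform l σ φ → Uniform l σ fun i => f i (φ i)) :
    Uniform l σ fun i => Par.lfp (f i) := by
  have happrox (a : ι → Ordinal.{0}) : Uniform l σ fun i => lfpApprox (f i) (a i) := by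
    induction a using (wellFounded_eventually_lt (α := Ordinal.{0}) l).induction with
    | _ a ih =>
      refine uniform_of_isLUB (fun i => isLUB_lfpApprox Par.exists_isLUB (hmono i) (a i))
        fun ψ hψ => ?_
      have hstage : ∀ᶠ i in l, ∃ b < a i, f i (lfpApprox (f i) b) = ψ i :=
        hψ.mono fun i ⟨b, hb⟩ => ⟨b, b.2, hb⟩
      obtain ⟨b, hb⟩ := hstage.choice
      exact (hf _ (ih b (hb.mono fun _ hi => hi.1))).congr (hb.mono fun _ hi => hi.2)
  choose a ha using fun i => Par.exists_lfpApprox_eq_lfp (hmono i)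
  simpa only [ha] using happrox a

theorem Uniform.eventually_eq_nat {a : ι → ℕ} (ha : Uniform l .nat fun i => Tot.toPar .nat (a i)) :
    ∃ n, ∀ᶠ i in l, a i = n := by
  obtain ⟨n, hn⟩ := ha (Eventually.of_forall fun _ => trivial)
  exact ⟨n, hn.mono fun _ hi => Part.some_injective hi⟩

theorem uniform_const_of_rank_le_one [l.NeBot] : ∀ {σ : Ty}, σ.rank ≤ 1 → ∀ φ : Par σ,
    Uniform l σ fun _ => φ
  | .nat, _, φ => uniform_nat_const φ
  | .arr .nat _, h, φ => fun _ ha => by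
    obtain ⟨n, hn⟩ := ha.eventually_eq_nat
    exact (uniform_const_of_rank_le_one (le_of_max_le_right h) (φ n)).congr
      (hn.mono fun _ hi => congrArg φ hi.symm)
  | .arr (.arr _ _) _, h, _ => by
    simp only [Ty.rank] at h
    omega

theorem Uniform.eventually_eq_of_rank_le_one [l.NeBot] [CountableInterFilter l] :
    ∀ {σ : Ty}, σ.rank ≤ 1 → ∀ {a : ι → Tot σ}, Uniform l σ (fun i => Tot.toPar σ (a i)) →
      ∃ x, ∀ᶠ i in l, a i = x
  | .nat, _, _, ha => ha.eventually_eq_nat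
  | .arr .nat _, h, a, ha => by
    have hval (n : ℕ) : ∃ y, ∀ᶠ i in l, a i n = y :=
      Uniform.eventually_eq_of_rank_le_one (le_of_max_le_right h)
        (ha (fun _ => n) (uniform_nat_const _))
    choose x hx using hval
    exact ⟨x, (eventually_countable_forall.2 hx).mono fun _ hi => funext hi⟩
  | .arr (.arr _ _) _, h, _, _ => by
    simp only [Ty.rank] at h
    omega

/-- Families of assignments that are uniform at each variable. -/
def UniformEnv (l : Filter ι) {Γ : List Ty} (ρ : ι → Env Γ) : Prop :=
  ∀ {σ : Ty} (x : Var Γ σ), Uniform l σ fun i => (ρ i).get x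

theorem UniformEnv.cons {Γ : List Ty} {σ : Ty} {ρ : ι → Env Γ} {φ : ι → Par σ}
    (hφ : Uniform l σ φ) (hρ : UniformEnv l ρ) :
    UniformEnv l (Γ := σ :: Γ) fun i => (φ i, ρ i)
  | _, .here => hφ
  | _, .there x => hρ x

theorem Term.uniform_interp [l.NeBot] [CountableInterFilter l] {Γ : List Ty} {σ : Ty}
    (t : Term Γ σ) : ∀ {ρ : ι → Env Γ}, UniformEnv l ρ → Uniform l σ fun i => t.interp (ρ i) := by
  induction t with
  | var _ x => exact fun h => h x
  | zero => exact fun _ => uniform_nat_const _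
  | suc => exact fun _ => uniform_const_of_rank_le_one (σ := .one) le_rfl _
  | pred => exact fun _ => uniform_const_of_rank_le_one (σ := .one) le_rfl _
  | case z x y hz hx hy => exact fun h => (hz h).caseVal (hx h) (hy h)
  | app u v hu hv => exact fun h => (hu h).app (hv h)
  | lam _ _ ht => exact fun h a ha => ht (h.cons ha)
  | mu _ t ht =>
    exact fun {ρ} h => Uniform.lfp
      (fun i _ _ hψ => t.interp_mono (ρ := (_, ρ i)) (ρ' := (_, ρ i)) ⟨hψ, Env.Le.refl _⟩)
      fun φ hφ => ht (h.cons hφ)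

theorem ComputableIn.uniform [l.NeBot] [CountableInterFilter l] {Γ : List Ty} {φ : Env Γ} {τ : Ty}
    {ψ : Par τ} (hψ : ComputableIn ψ φ) (hφ : UniformEnv l fun _ => φ) :
    Uniform l τ fun _ => ψ := by
  obtain ⟨s, hs⟩ := hψ
  exact (s.uniform_interp hφ).mono (Eventually.of_forall fun _ => hs)

/-- Families of argument tuples that are uniform at each position. -/
def UniformArgs (l : Filter ι) : (σ : Ty) → (ι → Args σ) → Prop
  | .nat, _ => True
  | .arr σ τ, a => Uniform l σ (fun i => Tot.toPar σ (a i).1) ∧ UniformArgs l τ fun i => (a i).2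

theorem uniform_toPar_iff : ∀ {σ : Ty} {φ : ι → Tot σ},
    Uniform l σ (fun i => Tot.toPar σ (φ i)) ↔
      ∀ a : ι → Args σ, UniformArgs l σ a → ∃ n, ∀ᶠ i in l, (φ i).eval (a i) = n
  | .nat, _ => by
    refine ⟨fun h _ _ => h.eventually_eq_nat, fun h _ => ?_⟩
    obtain ⟨n, hn⟩ := h (fun _ => ()) trivial
    exact ⟨n, hn.mono fun _ hi => congrArg Part.some hi⟩
  | .arr _ _, _ =>
    ⟨fun h a ha => uniform_toPar_iff.1 (h _ ha.1) _ ha.2, fun h b hb =>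
      uniform_toPar_iff.2 fun a ha => h (fun i => (b i, a i)) ⟨hb, ha⟩⟩

theorem uniformArgs_const_of_rank_le_two [l.NeBot] : ∀ {σ : Ty}, σ.rank ≤ 2 → ∀ a : Args σ,
    UniformArgs l σ fun _ => a
  | .nat, _, _ => trivial
  | .arr _ _, h, a =>
    ⟨uniform_const_of_rank_le_one (Nat.le_of_succ_le_succ (le_of_max_le_left h)) _,
      uniformArgs_const_of_rank_le_two (le_of_max_le_right h) a.2⟩

theorem Tot.exists_eval_eq : ∀ {σ : Ty} (g : Args σ → ℕ), ∃ φ : Tot σ, ∀ a, φ.eval a = g a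
  | .nat, g => ⟨g (), fun _ => rfl⟩
  | .arr _ _, g => by
    choose φ hφ using fun x => Tot.exists_eval_eq fun a => g (x, a)
    exact ⟨φ, fun a => hφ a.1 a.2⟩

theorem Uniform.exists_eventually_eval_eq [l.NeBot] {σ : Ty} (hσ : σ.rank ≤ 2) {φ : ι → Tot σ}
    (hφ : Uniform l σ fun i => Tot.toPar σ (φ i)) :
    ∃ ψ : Tot σ, ∀ b, ∀ᶠ i in l, ψ.eval b = (φ i).eval b := by
  choose g hg using fun b => uniform_toPar_iff.1 hφ _ (uniformArgs_const_of_rank_le_two hσ b)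
  obtain ⟨ψ, hψ⟩ := Tot.exists_eval_eq g
  exact ⟨ψ, fun b => (hg b).mono fun _ hi => (hψ b).trans hi.symm⟩

theorem UniformArgs.exists_eventually_agree [l.NeBot] [CountableInterFilter l] :
    ∀ {σ : Ty}, σ.rank ≤ 3 → ∀ {a : ι → Args σ}, UniformArgs l σ a →
      ∃ b : Args σ, ∀ X : Support σ, X.Countable → ∀ᶠ i in l, X.Agree b (a i)
  | .nat, _, _, _ => ⟨(), fun _ _ => Eventually.of_forall fun _ => trivial⟩
  | .arr _ _, h, _, ha => by
    obtain ⟨ψ, hψ⟩ :=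
      ha.1.exists_eventually_eval_eq (Nat.le_of_succ_le_succ (le_of_max_le_left h))
    obtain ⟨b, hb⟩ := UniformArgs.exists_eventually_agree (le_of_max_le_right h) ha.2
    exact ⟨(ψ, b), fun X hX =>
      ((eventually_countable_ball hX.1).2 fun x _ => hψ x).and (hb X.2 hX.2)⟩

theorem CountablyBased.uniform [l.NeBot] [CountableInterFilter l] {σ : Ty} (hσ : σ.rank ≤ 3)
    {Φ : Tot σ} (hΦ : CountablyBased Φ) : Uniform l σ fun _ => Tot.toPar σ Φ := by
  refine uniform_toPar_iff.2 fun a ha => ?_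
  obtain ⟨b, hb⟩ := ha.exists_eventually_agree hσ
  obtain ⟨X, hX, hΦX⟩ := hΦ b
  exact ⟨Φ.eval b, (hb X hX).mono fun i hi => (hΦX _ hi).symm⟩

end Uniform

section Omega1

open Classical in
/-- The characteristic function of `{x}`, as a total functional of type `2`. -/
noncomputable def singletonChar (x : ℕ → ℕ) : Tot .two :=
  fun y : ℕ → ℕ => (if y = x then 1 else 0 : ℕ)

theorem isChar_singletonChar (x : ℕ → ℕ) : IsChar (singletonChar x) {x} := fun _ =>
  ⟨fun h => if_pos h, fun h => if_neg h⟩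

theorem IsChar.unique {F : (ℕ → ℕ) → ℕ} {X Y : Set (ℕ → ℕ)} (hX : IsChar F X) (hY : IsChar F Y) :
    X = Y := by
  ext y
  by_contra hne
  have := hX y
  have := hY y
  grind

theorem Omega1_singletonChar (x : ℕ → ℕ) : Omega1 (singletonChar x) = Tot.toPar .one x := by
  have h : ∃ z, IsChar (singletonChar x) {z} := ⟨x, isChar_singletonChar x⟩
  have hx : h.choose = x := singleton_injective (h.choose_spec.unique (isChar_singletonChar x))
  exact funext fun k => Part.eq_some_iff.2 ⟨h, congrFun hx k⟩

instance {α : Type*} : CountableInterFilter (cocountable : Filter α) :=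
  cardinalInterFilter_aleph_one_iff.1 inferInstance

instance {α : Type*} [Uncountable α] : (cocountable : Filter α).NeBot :=
  ⟨fun h => not_countable_univ <| by simpa [h] using mem_cocountable (α := α) (s := ∅)⟩

instance : Uncountable (ℕ → ℕ) := by
  rw [← Cardinal.aleph0_lt_mk_iff]
  simp [Cardinal.aleph0_lt_continuum]

theorem uniform_singletonChar :
    Uniform cocountable .two fun x : ℕ → ℕ => Tot.toPar .two (singletonChar x) := by
  intro a ha
  obtain ⟨y, hy⟩ := ha.eventually_eq_of_rank_le_one le_rfl
  refine (uniform_nat_const (Part.some 0)).congr ?_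
  filter_upwards [hy, eventually_cocardinal_ne y] with x hxy hne
  have hzero : singletonChar x (a x) = (0 : ℕ) := if_neg (hxy.trans_ne hne.symm)
  exact (congrArg (Part.some (α := ℕ)) hzero).symm

theorem not_uniform_Omega1 :
    ¬ Uniform (cocountable : Filter (ℕ → ℕ)) (.arr .two .one) fun _ => Omega1 := by
  intro h
  have hid : Uniform cocountable .one fun x : ℕ → ℕ => Tot.toPar .one x := by
    simpa only [Omega1_singletonChar] using h singletonChar uniform_singletonChar
  obtain ⟨y, hy⟩ := hid.eventually_eq_of_rank_le_one le_rfl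
  obtain ⟨x, hxy, hne⟩ := (hy.and (eventually_cocardinal_ne y)).exists
  exact hne hxy

end Omega1

end HigherComp

open HigherComp in
theorem theorem31_general {Γ : List Ty} {φ : Env Γ}
    (hφ : ∀ {σ : Ty} (x : Var Γ σ), σ.rank ≤ 3 ∧
      ∃ Φ : Tot σ, CountablyBased Φ ∧ φ.get x = Tot.toPar σ Φ) :
    ¬ ComputableIn Omega1 φ := by
  intro h
  refine not_uniform_Omega1 (h.uniform fun x => ?_)
  obtain ⟨hσ, Φ, hΦ, hx⟩ := hφ x
  simpa only [hx] using hΦ.uniform hσ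

theorem theorem31 (σ : HigherComp.Ty) (hσ : σ.rank = 3) (Φ : HigherComp.Tot σ)
    (hΦ : HigherComp.CountablyBased Φ) :
    ¬ HigherComp.ComputableIn HigherComp.Omega1 (Γ := [σ]) (HigherComp.Tot.toPar σ Φ, ()) :=
  theorem31_general fun | .here => ⟨hσ.le, Φ, hΦ, rfl⟩
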